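/- **Setting.** For a Borel measure $m$ on $\mathbb R^d$ with finite moments up to order $2t$, its Christoffel function of degree $t\in\mathbb N$ is $$\Lambda^m_t(z)=\inf\Big\{\int p^2\,dm \;:\; p\in\mathbb R[z_1,\dots,z_d],\ \deg p\le t,\ p(z)=1\Big\},\qquad z\in\mathbb R^d .$$ Let $\Omega=\mathbf X\times\mathbf Y\subset\mathbb R^n\times\mathbb R$ be compact with nonempty interior, $\Omega=\overline{\mathrm{int}(\Omega)}$ and $\mathbf X=\overline{\mathrm{int}(\mathbf X)}$. Let $\mu$ be a finite Borel measure on $\Omega$ which has a density $f$ with respect to Lebesgue measure on $\mathbb R^{n+1}$ with $f\ge c$ on $\Omega$ for some constant $c>0$, and let $\phi$ be the marginal of $\mu$ on $\mathbb R^n$. For a point $\mathbf x\in\mathbf X$ and $t\in\mathbb N$, denote by $\nu_{\mathbf x,t}$ a positive Borel measure on $\mathbb R$ with finite moments up to order $2t$ such that $$\Lambda^\mu_t(\mathbf x,z)=\Lambda^\phi_t(\mathbf x)\cdot\Lambda^{\nu_{\mathbf x,t}}_t(z)\qquad\text{for all } z\in\mathbb R .$$ Let $\hat\mu(dy\,|\,\mathbf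 x)$ be a conditional distribution, i.e. a probability kernel with $\mu(d\mathbf x,dy)=\hat\mu(dy\,|\,\mathbf x)\,\phi(d\mathbf x)$ such that $\hat\mu(\cdot\,|\,\mathbf x)$ is carried by $\mathbf Y$ for every $\mathbf x\in\mathbf X$. **Corollary.** Let $\mathbf x\in\mathrm{int}(\mathbf X)$ and let $y\in\mathbb R$ be such that $(\mathbf x,y)\notin\Omega$. Then: 1. measures $\nu_{\mathbf x,t}$ as above exist for every $t\in\mathbb N$, and for every choice of them $\Lambda^{\nu_{\mathbf x,t}}_t(y)$ is positive and tends to $0$ exponentially fast in $t$: there are $C>0$ and $r\in(0,1)$ with $0<\Lambda^{\nu_{\mathbf x,t}}_t(y)\le C\,r^t$ for all $t\in\mathbb N$; 2. for every such conditional distribution, the Christoffel function $\Lambda^{\hat\mu(\cdot|\mathbf x)}_t(y)$ is nonincreasing in $t$ and tends to $0$ exponentially fast: there are $C>0$ and $r\in(0,1)$ with $0\le\Lambda^{\hat\mu(\cdot|\mathbf x)}_t(y)\le C\,r^t$ for all $t\in\mathbb N$. -/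

import Mathlib

open MeasureTheory ProbabilityTheory
open scoped NNReal ENNReal

/-- The Christoffel function of degree `t` of a measure `m` on a space `E` whose points `w` have
the real coordinates `c w : σ → ℝ`, in its variational form:
`Λ_t(z) = inf { ∫ p² dm : p a polynomial of total degree at most t with p(z) = 1 }`. -/
noncomputable def christoffel {E σ : Type*} [MeasurableSpace E] (c : E → σ → ℝ)
    (m : Measure E) (t : ℕ) (z : E) : ℝ :=
  sInf {s : ℝ | ∃ p : MvPolynomial σ ℝ, p.totalDegree ≤ t ∧ MvPolynomial.eval (c z) p = 1 ∧
    s = ∫ w, (MvPolynomial.eval (c w) p) ^ 2 ∂m}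

/-- The Christoffel function of a measure on `ℝⁿ`. -/
noncomputable def christoffelX {n : ℕ} (φ : Measure (Fin n → ℝ)) (t : ℕ) (x : Fin n → ℝ) : ℝ :=
  christoffel (fun w => w) φ t x

/-- The Christoffel function of a measure on `ℝⁿ × ℝ`: polynomials in the `n + 1` coordinates. -/
noncomputable def christoffelXY {n : ℕ} (μ : Measure ((Fin n → ℝ) × ℝ)) (t : ℕ)
    (z : (Fin n → ℝ) × ℝ) : ℝ :=
  christoffel (σ := Fin n ⊕ Fin 1) (fun w => Sum.elim w.1 (fun _ => w.2)) μ t z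

/-- The Christoffel function of a measure on `ℝ`: polynomials in one variable. -/
noncomputable def christoffelY (ν : Measure ℝ) (t : ℕ) (y : ℝ) : ℝ :=
  christoffel (σ := Fin 1) (fun w => fun _ => w) ν t y

/-- `ν` is a measure `ν_{x,t}`: a Borel measure on `ℝ` with finite moments up to order `2t` such
that `Λ^μ_t(x, z) = Λ^φ_t(x) · Λ^ν_t(z)` for all real `z`, where `φ` is the marginal of `μ`
on `ℝⁿ`. -/
def IsChristoffelDisintegration {n : ℕ} (μ : Measure ((Fin n → ℝ) × ℝ)) (x : Fin n → ℝ) (t : ℕ)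
    (ν : Measure ℝ) : Prop :=
  (∀ k ≤ 2 * t, Integrable (fun z : ℝ => z ^ k) ν) ∧
    ∀ z : ℝ, christoffelXY μ t (x, z) = christoffelX μ.fst t x * christoffelY ν t z

/-- `κ` is a conditional distribution of the second variable given the first one, for the measure
`μ` on `X × Y`: `μ(dx, dy) = κ(dy | x) φ(dx)` with `φ` the marginal of `μ`, and `κ(· | x)` is
carried by `Y` for every `x ∈ X`. -/
def IsConditional {n : ℕ} (μ : Measure ((Fin n → ℝ) × ℝ)) (X : Set (Fin n → ℝ)) (Y : Set ℝ)
    (κ : Kernel (Fin n → ℝ) ℝ) : Prop :=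
  IsMarkovKernel κ ∧ μ.fst ⊗ₘ κ = μ ∧ ∀ x ∈ X, κ x Yᶜ = 0

/-- Convergence to `0` at an exponential rate. -/
def DecaysExponentially (a : ℕ → ℝ) : Prop :=
  ∃ C r : ℝ, 0 < C ∧ 0 < r ∧ r < 1 ∧ ∀ t : ℕ, |a t| ≤ C * r ^ t

/-! ### The variational problem and its upper bounds. -/

section Basics

variable {E σ : Type*} [MeasurableSpace E] (c : E → σ → ℝ) (m : Measure E) (t : ℕ) (z : E)

/-! Off a compact set carrying the measure, a quadratic polynomial peaks at the point and stays
below some `ρ < 1` on the set (`exists_needle`). Its powers are competitors in the infimum, so the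
Christoffel function is O(ρ^t) (`christoffel_le_of_needle`). This settles `κ x` at `y ∉ Y` directly,
and bounds Λ^μ_t(x,y). Since `x` is interior and the marginal φ dominates a multiple of Lebesgue
measure on `X`, Λ^φ_t(x) is at least of order t^(-2n) (`exists_le_christoffelX`). The quotient
Λ^ν_t(y) therefore still decays exponentially.

Existence of ν is an algebraic matter. By the reproducing kernel formula (`christoffel_eq_inv`),
1/Λ^μ_t(x,z) is a polynomial in z with a positive definite Gram matrix in 1, …, z^t. Among all
positive semidefinite Gram matrices of this polynomial, scaled by Λ^φ_t(x), one of maximal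
determinant has a Hankel inverse (`Matrix.PosDef.exists_hankel_inv`). Such a Hankel matrix is the
moment matrix of an atomic measure (`exists_quadrature_of_hankel_posDef`), which is the required ν.
-/

theorem christoffel_bddBelow :
    BddBelow {s : ℝ | ∃ p : MvPolynomial σ ℝ, p.totalDegree ≤ t ∧ MvPolynomial.eval (c z) p = 1 ∧
      s = ∫ w, (MvPolynomial.eval (c w) p) ^ 2 ∂m} :=
  ⟨0, by rintro s ⟨p, -, -, rfl⟩; exact integral_nonneg fun w => sq_nonneg _⟩

theorem christoffel_set_nonempty :
    {s : ℝ | ∃ p : MvPolynomial σ ℝ, p.totalDegree ≤ t ∧ MvPolynomial.eval (c z) p = 1 ∧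
      s = ∫ w, (MvPolynomial.eval (c w) p) ^ 2 ∂m}.Nonempty :=
  ⟨_, 1, by simp, by simp, rfl⟩

variable {t z} in
theorem christoffel_le {p : MvPolynomial σ ℝ} (hp : p.totalDegree ≤ t)
    (hz : MvPolynomial.eval (c z) p = 1) :
    christoffel c m t z ≤ ∫ w, (MvPolynomial.eval (c w) p) ^ 2 ∂m :=
  csInf_le (christoffel_bddBelow c m t z) ⟨p, hp, hz, rfl⟩

variable {t z} in
theorem le_christoffel {a : ℝ} (h : ∀ p : MvPolynomial σ ℝ, p.totalDegree ≤ t →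
    MvPolynomial.eval (c z) p = 1 → a ≤ ∫ w, (MvPolynomial.eval (c w) p) ^ 2 ∂m) :
    a ≤ christoffel c m t z :=
  le_csInf (christoffel_set_nonempty c m t z) <| by
    rintro s ⟨p, hp, hz, rfl⟩; exact h p hp hz

theorem christoffel_nonneg : 0 ≤ christoffel c m t z :=
  le_christoffel c m fun _ _ _ => integral_nonneg fun _ => sq_nonneg _

theorem christoffel_antitone : Antitone fun t => christoffel c m t z := by
  intro s t hst
  refine csInf_le_csInf (christoffel_bddBelow c m t z) (christoffel_set_nonempty c m s z) ?_
  rintro _ ⟨p, hp, hz, rfl⟩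
  exact ⟨p, hp.trans hst, hz, rfl⟩

variable {z} in
/-- A quadratic polynomial that peaks at `z` and stays below `ρ` on the support of the measure
forces the Christoffel function at `z` to decay geometrically. -/
theorem christoffel_le_of_needle [IsFiniteMeasure m] {q : MvPolynomial σ ℝ}
    (hq : q.totalDegree ≤ 2) (hz : MvPolynomial.eval (c z) q = 1) {ρ : ℝ} (hρ : 0 < ρ)
    (hρ1 : ρ ≤ 1) (h : ∀ᵐ w ∂m, |MvPolynomial.eval (c w) q| ≤ ρ) :
    christoffel c m t z ≤ m.real Set.univ / ρ * ρ ^ t := by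
  -- Since `q` has degree 2, the exponent is t/2. Rounding down loses at most one factor `ρ`, hence
  -- the division by `ρ` in the bound.
  have hdeg : (q ^ (t / 2)).totalDegree ≤ t :=
    (MvPolynomial.totalDegree_pow _ _).trans
      ((Nat.mul_le_mul_left _ hq).trans (Nat.div_mul_le_self t 2))
  refine (christoffel_le c m hdeg (by simp [hz])).trans ?_
  have hbound : ∀ᵐ w ∂m, ‖(MvPolynomial.eval (c w) (q ^ (t / 2))) ^ 2‖ ≤ ρ ^ t / ρ := by
    filter_upwards [h] with w hw
    have h1 : ‖(MvPolynomial.eval (c w) (q ^ (t / 2))) ^ 2‖ ≤ ρ ^ (2 * (t / 2)) := by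
      rw [map_pow, ← pow_mul, norm_pow, Real.norm_eq_abs, mul_comm]
      exact pow_le_pow_left₀ (abs_nonneg _) hw _
    refine h1.trans ?_
    rw [le_div_iff₀ hρ, ← pow_succ]
    exact pow_le_pow_of_le_one hρ.le hρ1 (by omega)
  calc _ ≤ ‖∫ w, (MvPolynomial.eval (c w) (q ^ (t / 2))) ^ 2 ∂m‖ := le_abs_self _
    _ ≤ ρ ^ t / ρ * m.real Set.univ := norm_integral_le_of_norm_le_const hbound
    _ = _ := by ring

end Basics

/-! ### The reproducing kernel formula. -/

section MomentMatrix

open Matrix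

/-- The matrix of the second moments of a family of functions. -/
noncomputable def momentMatrix {E ι : Type*} [MeasurableSpace E] (m : Measure E)
    (b : ι → E → ℝ) : Matrix ι ι ℝ :=
  Matrix.of fun i j => ∫ w, b i w * b j w ∂m

variable {E σ ι : Type*} [MeasurableSpace E]

theorem momentMatrix_isHermitian (m : Measure E) (b : ι → E → ℝ) :
    (momentMatrix m b).IsHermitian := by
  ext i j
  simp [momentMatrix, mul_comm]

variable [Fintype ι]

theorem integral_sq_sum_eq (m : Measure E) (b : ι → E → ℝ)
    (hint : ∀ i j, Integrable (fun w => b i w * b j w) m) (a : ι → ℝ) :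
    ∫ w, (∑ i, a i * b i w) ^ 2 ∂m = a ⬝ᵥ (momentMatrix m b *ᵥ a) := by
  have h : ∀ w, (∑ i, a i * b i w) ^ 2 = ∑ i, ∑ j, (a i * a j) * (b i w * b j w) := by
    intro w
    rw [sq, Finset.sum_mul_sum]
    exact Finset.sum_congr rfl fun i _ => Finset.sum_congr rfl fun j _ => by ring
  simp_rw [h]
  rw [integral_finsetSum _ fun i _ => integrable_finsetSum _ fun j _ => (hint i j).const_mul _]
  simp_rw [dotProduct, mulVec, dotProduct, Finset.mul_sum]
  refine Finset.sum_congr rfl fun i _ => ?_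
  rw [integral_finsetSum _ fun j _ => (hint i j).const_mul _]
  refine Finset.sum_congr rfl fun j _ => ?_
  rw [integral_const_mul]
  simp [momentMatrix]
  ring

theorem Matrix.IsHermitian.dotProduct_mulVec_comm_real {M : Matrix ι ι ℝ} (hM : M.IsHermitian)
    (u v : ι → ℝ) : u ⬝ᵥ (M *ᵥ v) = v ⬝ᵥ (M *ᵥ u) := by
  have : Mᵀ = M := by simpa [IsHermitian] using hM
  rw [dotProduct_mulVec, ← mulVec_transpose, this, dotProduct_comm]

variable [DecidableEq ι]

/-- The Christoffel function is the reciprocal of the diagonal of the reproducing kernel. -/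
theorem christoffel_eq_inv (c : E → σ → ℝ) (m : Measure E) (t : ℕ) (z : E) (b : ι → E → ℝ)
    (hspan : ∀ p : MvPolynomial σ ℝ, p.totalDegree ≤ t →
      ∃ a : ι → ℝ, ∀ w, MvPolynomial.eval (c w) p = ∑ i, a i * b i w)
    (hpoly : ∀ a : ι → ℝ, ∃ p : MvPolynomial σ ℝ, p.totalDegree ≤ t ∧
      ∀ w, MvPolynomial.eval (c w) p = ∑ i, a i * b i w)
    (hint : ∀ i j, Integrable (fun w => b i w * b j w) m) (hM : (momentMatrix m b).PosDef) :
    0 < (fun i => b i z) ⬝ᵥ ((momentMatrix m b)⁻¹ *ᵥ fun i => b i z) ∧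
    christoffel c m t z =
      ((fun i => b i z) ⬝ᵥ ((momentMatrix m b)⁻¹ *ᵥ fun i => b i z))⁻¹ := by
  set M := momentMatrix m b
  set v : ι → ℝ := fun i => b i z with hv
  set K := v ⬝ᵥ (M⁻¹ *ᵥ v) with hK
  -- The constant 1 lies in the span of `b`, so the `b i` have no common zero.
  have hv0 : v ≠ 0 := by
    intro h0
    obtain ⟨a, ha⟩ := hspan 1 (by simp)
    have h1 := ha z
    simp only [map_one] at h1
    have : ∀ i, b i z = 0 := fun i => congrFun h0 i
    simp [this] at h1
  have hKpos : 0 < K := by simpa using hM.inv.dotProduct_mulVec_pos hv0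
  have hMu : IsUnit M.det := (isUnit_iff_isUnit_det _).1 hM.isUnit
  have hMv : M *ᵥ (M⁻¹ *ᵥ v) = v := by
    rw [mulVec_mulVec, mul_nonsing_inv _ hMu, one_mulVec]
  refine ⟨hKpos, IsLeast.csInf_eq ⟨?_, ?_⟩⟩
  -- The minimizer is the kernel at `z`, normalized to take the value 1 there.
  · obtain ⟨p, hp, hpe⟩ := hpoly (K⁻¹ • (M⁻¹ *ᵥ v))
    refine ⟨p, hp, ?_, ?_⟩
    · rw [hpe]
      change (K⁻¹ • (M⁻¹ *ᵥ v)) ⬝ᵥ v = 1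
      rw [smul_dotProduct, dotProduct_comm, ← hK, smul_eq_mul, inv_mul_cancel₀ hKpos.ne']
    · simp_rw [hpe]
      rw [integral_sq_sum_eq m b hint]
      change _ = (K⁻¹ • (M⁻¹ *ᵥ v)) ⬝ᵥ (M *ᵥ (K⁻¹ • (M⁻¹ *ᵥ v)))
      rw [mulVec_smul, hMv, smul_dotProduct, dotProduct_smul, dotProduct_comm, ← hK]
      simp [inv_mul_cancel₀ hKpos.ne']
  · rintro s ⟨p, hp, hpz, rfl⟩
    obtain ⟨a, ha⟩ := hspan p hp
    simp_rw [ha]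
    rw [integral_sq_sum_eq m b hint]
    have hav : a ⬝ᵥ v = 1 := by rw [← hpz, ha]; rfl
    -- Completing the square around the minimizer: this expands to aᵀMa − 1/K.
    have h0 : 0 ≤ (a - K⁻¹ • (M⁻¹ *ᵥ v)) ⬝ᵥ (M *ᵥ (a - K⁻¹ • (M⁻¹ *ᵥ v))) := by
      simpa using hM.posSemidef.dotProduct_mulVec_nonneg (a - K⁻¹ • (M⁻¹ *ᵥ v))
    rw [mulVec_sub, mulVec_smul, hMv, sub_dotProduct, dotProduct_sub, dotProduct_sub,
      smul_dotProduct, smul_dotProduct, dotProduct_smul, dotProduct_smul, hav,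
      dotProduct_comm (M⁻¹ *ᵥ v) v, ← hK,
      hM.isHermitian.dotProduct_mulVec_comm_real (M⁻¹ *ᵥ v) a, hMv, hav] at h0
    simp only [smul_eq_mul, inv_mul_cancel₀ hKpos.ne'] at h0
    change K⁻¹ ≤ a ⬝ᵥ (M *ᵥ a)
    linarith

end MomentMatrix

/-! ### Maximizing the determinant. -/

section MaxDet

open Matrix

variable {ι : Type*} [Fintype ι]

theorem Matrix.abs_dotProduct_mulVec_le (D : Matrix ι ι ℝ) (x : ι → ℝ) :
    |x ⬝ᵥ (D *ᵥ x)| ≤ (∑ i, ∑ j, |D i j|) * (x ⬝ᵥ x) := by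
  have hx : ∀ i, x i ^ 2 ≤ x ⬝ᵥ x := fun i => by
    rw [dotProduct, sq]
    exact Finset.single_le_sum (f := fun i => x i * x i) (fun j _ => mul_self_nonneg _)
      (Finset.mem_univ i)
  have hexp : x ⬝ᵥ (D *ᵥ x) = ∑ i, ∑ j, x i * (D i j * x j) := by
    simp [dotProduct, mulVec, Finset.mul_sum]
  rw [hexp]
  simp_rw [Finset.sum_mul]
  refine (Finset.abs_sum_le_sum_abs _ _).trans (Finset.sum_le_sum fun i _ => ?_)
  refine (Finset.abs_sum_le_sum_abs _ _).trans (Finset.sum_le_sum fun j _ => ?_)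
  rw [show x i * (D i j * x j) = D i j * (x i * x j) by ring, abs_mul]
  refine mul_le_mul_of_nonneg_left ?_ (abs_nonneg _)
  rw [abs_le]
  constructor <;> nlinarith [hx i, hx j, sq_nonneg (x i - x j), sq_nonneg (x i + x j)]

variable [DecidableEq ι]

theorem Matrix.exists_posSemidef_one_add_smul {D : Matrix ι ι ℝ} (hD : D.IsHermitian) :
    ∃ δ > 0, ∀ ε : ℝ, |ε| ≤ δ → (1 + ε • D).PosSemidef := by
  set S := ∑ i, ∑ j, |D i j|
  have hS : 0 ≤ S := Finset.sum_nonneg fun i _ => Finset.sum_nonneg fun j _ => abs_nonneg _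
  refine ⟨(S + 1)⁻¹, by positivity, fun ε hε => ?_⟩
  refine PosSemidef.of_dotProduct_mulVec_nonneg ?_ fun x => ?_
  · rw [IsHermitian, conjTranspose_add, conjTranspose_smul, hD.eq]
    simp
  · have h1 := abs_dotProduct_mulVec_le D x
    have h2 : 0 ≤ x ⬝ᵥ x := Finset.sum_nonneg fun i _ => mul_self_nonneg _
    rw [star_trivial, add_mulVec, one_mulVec, dotProduct_add, smul_mulVec, dotProduct_smul,
      smul_eq_mul]
    have h3 : |ε * (x ⬝ᵥ (D *ᵥ x))| ≤ (S + 1)⁻¹ * (S * (x ⬝ᵥ x)) := by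
      rw [abs_mul]; exact mul_le_mul hε h1 (abs_nonneg _) (by positivity)
    have h4 : (S + 1)⁻¹ * (S * (x ⬝ᵥ x)) ≤ x ⬝ᵥ x := by
      rw [inv_mul_le_iff₀ (by positivity)]; nlinarith
    linarith [neg_abs_le (ε * (x ⬝ᵥ (D *ᵥ x)))]

open scoped MatrixOrder in
theorem Matrix.PosDef.exists_eq_transpose_mul_self {A : Matrix ι ι ℝ} (hA : A.PosDef) :
    ∃ B : Matrix ι ι ℝ, IsUnit B.det ∧ A = Bᵀ * B := by
  obtain ⟨B, hB⟩ := CStarAlgebra.nonneg_iff_eq_star_mul_self.mp hA.posSemidef.nonneg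
  have hB' : A = Bᵀ * B := by rw [hB, star_eq_conjTranspose]; simp
  refine ⟨B, ?_, hB'⟩
  have := hA.det_pos
  rw [hB', det_mul, det_transpose] at this
  exact isUnit_iff_ne_zero.2 fun h => by simp [h] at this

/-- First-order condition for a local maximum of the determinant along a line. -/
theorem Matrix.PosDef.trace_inv_mul_eq_zero {A D : Matrix ι ι ℝ} (hA : A.PosDef)
    (hD : D.IsHermitian) (h : ∀ ε : ℝ, (A + ε • D).PosSemidef → (A + ε • D).det ≤ A.det) :
    (A⁻¹ * D).trace = 0 := by
  obtain ⟨B, hB, rfl⟩ := hA.exists_eq_transpose_mul_self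
  have hBt : IsUnit (Bᵀ).det := by rwa [det_transpose]
  -- The congruence by `B` moves the base point to the identity: A + εD = Bᵀ(1 + εF)B.
  set F := (Bᵀ)⁻¹ * D * B⁻¹ with hF
  have hDF : D = Bᵀ * F * B := by
    rw [hF, mul_assoc, nonsing_inv_mul_cancel_right _ _ hB,
      mul_nonsing_inv_cancel_left _ _ hBt]
  have hFh : F.IsHermitian := by
    have hDt : Dᵀ = D := by simpa [IsHermitian] using hD
    rw [IsHermitian, hF]
    simp [transpose_nonsing_inv, hDt, mul_assoc]
  have htr : ((Bᵀ * B)⁻¹ * D).trace = F.trace := by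
    rw [mul_inv_rev, hF, mul_assoc, trace_mul_comm, mul_assoc]
  have hline : ∀ ε : ℝ, Bᵀ * B + ε • D = Bᵀ * (1 + ε • F) * B := fun ε => by
    rw [mul_add, add_mul, mul_one, hDF]; simp
  obtain ⟨δ, hδ, hpsd⟩ := exists_posSemidef_one_add_smul hFh
  -- `g` is the remainder in det(1 + εF) = 1 + ε tr F + ε² g(ε).
  set g : Polynomial ℝ := (det (1 + (Polynomial.X : Polynomial ℝ) •
    F.map Polynomial.C)).divX.divX
  have hpos : 0 < B.det ^ 2 := by have := hB.ne_zero; positivity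
  have key : ∀ ε : ℝ, |ε| ≤ δ → F.trace * ε + g.eval ε * ε ^ 2 ≤ 0 := by
    intro ε hε
    have h1 := h ε <| by
      rw [hline]
      simpa using (hpsd ε hε).conjTranspose_mul_mul_same B
    rw [hline, det_mul, det_mul, det_mul, det_transpose, det_one_add_smul] at h1
    change B.det * (1 + F.trace * ε + g.eval ε * ε ^ 2) * B.det ≤ _ at h1
    nlinarith
  -- Dividing `key` by ε and letting ε → 0 from the right gives tr F ≤ 0, from the left tr F ≥ 0.
  have hlim : Filter.Tendsto (fun ε : ℝ => F.trace + g.eval ε * ε) (nhds 0)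
      (nhds F.trace) := by
    have : Continuous fun ε : ℝ => F.trace + g.eval ε * ε := by fun_prop
    simpa using this.tendsto 0
  have hlimr := hlim.mono_left (nhdsWithin_le_nhds (s := Set.Ioi 0))
  have hliml := hlim.mono_left (nhdsWithin_le_nhds (s := Set.Iio 0))
  rw [htr]
  apply le_antisymm
  · refine le_of_tendsto hlimr ?_
    filter_upwards [Ioo_mem_nhdsGT hδ] with ε hε
    have := key ε (by rw [abs_of_pos hε.1]; exact hε.2.le)
    by_contra! hc
    nlinarith [mul_pos hc hε.1]
  · refine ge_of_tendsto hliml ?_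
    filter_upwards [Ioo_mem_nhdsLT (neg_lt_zero.2 hδ)] with ε hε
    have := key ε (by rw [abs_of_neg hε.2]; linarith [hε.1])
    by_contra! hc
    nlinarith [mul_pos_of_neg_of_neg hc hε.2]

end MaxDet

/-! ### Gram matrices with Hankel inverse, and Gauss quadrature. -/

section Hankel

open Matrix

/-- The vector of monomials `(1, z, …, z ^ t)`. -/
def monomialVec (t : ℕ) (z : ℝ) : Fin (t + 1) → ℝ := fun i => z ^ (i : ℕ)

theorem Matrix.PosSemidef.abs_apply_le {ι : Type*} [Fintype ι] [DecidableEq ι]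
    {A : Matrix ι ι ℝ} (hA : A.PosSemidef) (i j : ι) : |A i j| ≤ (A i i + A j j) / 2 := by
  have hsymm : A j i = A i j := by simpa using hA.isHermitian.apply i j
  have h : ∀ s : ℝ, 0 ≤ A i i + s * (A i j + A i j) + s * s * A j j := fun s => by
    have := hA.dotProduct_mulVec_nonneg (Pi.single i 1 + s • Pi.single j 1)
    simp only [star_trivial, mulVec_add, mulVec_smul, mulVec_single_one, add_dotProduct,
      dotProduct_add, smul_dotProduct, dotProduct_smul, single_one_dotProduct, col_apply,
      smul_eq_mul, hsymm] at this
    linarith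
  have h1 := h 1
  have h2 := h (-1)
  rw [abs_le]
  constructor <;> linarith

/-- With W the Vandermonde matrix at the nodes 0, …, t, the diagonal of WQWᵀ consists of values of
`p`. The diagonal of a positive semidefinite matrix controls its entries, so WQWᵀ lies in a fixed
box, and W is invertible. The defining conditions are closed. -/
theorem isCompact_posSemidef_of_quadraticForm_eq (t : ℕ) (p : ℝ → ℝ) :
    IsCompact {Q : Matrix (Fin (t + 1)) (Fin (t + 1)) ℝ | Q.PosSemidef ∧
      ∀ z, monomialVec t z ⬝ᵥ (Q *ᵥ monomialVec t z) = p z} := by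
  set W : Matrix (Fin (t + 1)) (Fin (t + 1)) ℝ := vandermonde fun i => ((i : ℕ) : ℝ) with hW
  have hWu : IsUnit W.det := isUnit_iff_ne_zero.2 <| det_vandermonde_ne_zero_iff.2 <|
    fun i j h => Fin.ext (by exact_mod_cast h)
  have hWtu : IsUnit Wᵀ.det := by rwa [det_transpose]
  have hWrow : ∀ i, W i = monomialVec t ((i : ℕ) : ℝ) := fun i => by
    ext j; simp [hW, vandermonde_apply, monomialVec]
  set R : ℝ := ∑ i : Fin (t + 1), |p ((i : ℕ) : ℝ)|
  have hbox : IsCompact (Set.univ.pi fun _ : Fin (t + 1) => Set.univ.pi fun _ : Fin (t + 1) =>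
      Set.Icc (-R) R) := isCompact_univ_pi fun _ => isCompact_univ_pi fun _ => isCompact_Icc
  have himage := hbox.image (f := fun A : Matrix (Fin (t + 1)) (Fin (t + 1)) ℝ =>
    W⁻¹ * A * Wᵀ⁻¹) (by fun_prop)
  refine himage.of_isClosed_subset ?_ ?_
  · have hset : {Q : Matrix (Fin (t + 1)) (Fin (t + 1)) ℝ | Q.PosSemidef ∧
        ∀ z, monomialVec t z ⬝ᵥ (Q *ᵥ monomialVec t z) = p z} =
        {Q | Qᴴ = Q} ∩ (⋂ x : Fin (t + 1) → ℝ, {Q | 0 ≤ x ⬝ᵥ (Q *ᵥ x)}) ∩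
        ⋂ z : ℝ, {Q | monomialVec t z ⬝ᵥ (Q *ᵥ monomialVec t z) = p z} := by
      ext Q
      simp [posSemidef_iff_dotProduct_mulVec, IsHermitian]
    rw [hset]
    refine ((isClosed_eq (by fun_prop) (by fun_prop)).inter (isClosed_iInter fun x =>
      isClosed_le (by fun_prop) (by fun_prop))).inter (isClosed_iInter fun z =>
      isClosed_eq (by fun_prop) (by fun_prop))
  · rintro Q ⟨hQ, hQp⟩
    have hA : (W * Q * Wᵀ).PosSemidef := by simpa using hQ.mul_mul_conjTranspose_same W
    refine ⟨W * Q * Wᵀ, ?_, ?_⟩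
    · have hdiag : ∀ i, (W * Q * Wᵀ) i i ≤ R := fun i => by
        have h1 : (W * Q * Wᵀ) i i = p ((i : ℕ) : ℝ) := by
          rw [← hQp, ← hWrow]
          simp only [mul_apply, dotProduct, mulVec, Finset.mul_sum, Finset.sum_mul,
            transpose_apply]
          rw [Finset.sum_comm]
          exact Finset.sum_congr rfl fun j _ => Finset.sum_congr rfl fun k _ => by ring
        rw [h1]
        exact (le_abs_self _).trans (Finset.single_le_sum
          (f := fun i : Fin (t + 1) => |p ((i : ℕ) : ℝ)|) (fun _ _ => abs_nonneg _)
          (Finset.mem_univ i))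
      intro i _ j _
      exact abs_le.1 ((hA.abs_apply_le i j).trans (by linarith [hdiag i, hdiag j]))
    · change W⁻¹ * (W * Q * Wᵀ) * Wᵀ⁻¹ = Q
      rw [mul_assoc W, nonsing_inv_mul_cancel_left _ _ hWu, mul_nonsing_inv_cancel_right _ _ hWtu]

/-- A positive definite Gram representation of a univariate polynomial can be replaced by one
whose inverse is a Hankel matrix: the one of maximal determinant. -/
theorem Matrix.PosDef.exists_hankel_inv {t : ℕ} {Q₀ : Matrix (Fin (t + 1)) (Fin (t + 1)) ℝ}
    (hQ₀ : Q₀.PosDef) :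
    ∃ s : ℕ → ℝ, (Matrix.of fun i j : Fin (t + 1) => s (i + j)).PosDef ∧
      ∀ z, monomialVec t z ⬝ᵥ ((Matrix.of fun i j : Fin (t + 1) => s (i + j))⁻¹ *ᵥ
        monomialVec t z) = monomialVec t z ⬝ᵥ (Q₀ *ᵥ monomialVec t z) := by
  obtain ⟨Q, ⟨hQ, hQp⟩, hmax⟩ := (isCompact_posSemidef_of_quadraticForm_eq t
    fun z => monomialVec t z ⬝ᵥ (Q₀ *ᵥ monomialVec t z)).exists_isMaxOn
    ⟨Q₀, hQ₀.posSemidef, fun _ => rfl⟩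
    (f := fun Q : Matrix (Fin (t + 1)) (Fin (t + 1)) ℝ => Q.det) (by fun_prop)
  have hQdet : 0 < Q.det := hQ₀.det_pos.trans_le (hmax ⟨hQ₀.posSemidef, fun _ => rfl⟩)
  have hQpd : Q.PosDef := hQ.posDef_iff_det_ne_zero.2 hQdet.ne'
  set M := Q⁻¹ with hM
  have hMsymm : ∀ i j, M j i = M i j := fun i j => by
    simpa using hQpd.inv.isHermitian.apply i j
  have hhankel : ∀ i j k l : Fin (t + 1), (i : ℕ) + j = k + l → M i j = M k l := by
    intro i j k l hijkl
    -- As i + j = k + l, this direction leaves the represented polynomial unchanged; stationarity of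
    -- the determinant along it reads 2 M i j = 2 M k l.
    set D : Matrix (Fin (t + 1)) (Fin (t + 1)) ℝ :=
      (single i j 1 + single j i 1) - (single k l 1 + single l k 1) with hD
    have hDh : D.IsHermitian := by
      rw [IsHermitian, hD]
      simp [add_comm]
    have hD0 : ∀ z, monomialVec t z ⬝ᵥ (D *ᵥ monomialVec t z) = 0 := fun z => by
      have hs : ∀ a b : Fin (t + 1), monomialVec t z ⬝ᵥ (single a b (1 : ℝ) *ᵥ monomialVec t z) =
          z ^ ((a : ℕ) + b) := fun a b => by
        simp [single_mulVec, monomialVec, pow_add, dotProduct, Function.update_apply]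
      rw [hD, sub_mulVec, add_mulVec, add_mulVec, dotProduct_sub, dotProduct_add, dotProduct_add,
        hs, hs, hs, hs, hijkl, add_comm (j : ℕ), add_comm (l : ℕ), hijkl, sub_self]
    have := hQpd.trace_inv_mul_eq_zero hDh fun ε hε => hmax ⟨hε, fun z => by
      rw [add_mulVec, dotProduct_add, smul_mulVec, dotProduct_smul, hD0, smul_zero, add_zero, hQp]⟩
    rw [← hM, hD, mul_sub, mul_add, mul_add] at this
    simp only [trace_sub, trace_add, trace_mul_single] at this
    simp [hMsymm i j, hMsymm k l] at this
    linarith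
  -- The antidiagonal m ≤ 2t is represented by its entry (min m t, m − min m t); for such m the
  -- reduction in `Fin.ofNat` does nothing.
  have hs : (Matrix.of fun i j : Fin (t + 1) => M (Fin.ofNat (t + 1) (min ((i : ℕ) + j) t))
      (Fin.ofNat (t + 1) ((i : ℕ) + j - min ((i : ℕ) + j) t))) = M := by
    ext i j
    refine hhankel _ _ _ _ ?_
    simp only [Fin.ofNat]
    rw [Nat.mod_eq_of_lt (by omega), Nat.mod_eq_of_lt (by omega)]
    omega
  refine ⟨fun m => M (Fin.ofNat (t + 1) (min m t)) (Fin.ofNat (t + 1) (m - min m t)),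
    by rw [hs]; exact hQpd.inv, fun z => ?_⟩
  rw [hs, hM, nonsing_inv_nonsing_inv _ (isUnit_iff_ne_zero.2 hQdet.ne'), hQp]

/-- Gauss quadrature: a positive definite Hankel matrix is the moment matrix of a finitely
supported measure. -/
theorem exists_quadrature_of_hankel_posDef {t : ℕ} {s : ℕ → ℝ}
    (hM : (Matrix.of fun i j : Fin (t + 1) => s (i + j)).PosDef) :
    ∃ w x : Fin (t + 1) → ℝ, (∀ i, 0 ≤ w i) ∧ ∀ k ≤ 2 * t, s k = ∑ i, w i * x i ^ k := by
  obtain ⟨B, hB, hMB⟩ := hM.exists_eq_transpose_mul_self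
  have hBt : IsUnit Bᵀ.det := by rwa [det_transpose]
  -- `T` is multiplication by z compressed to degree ≤ t, in orthonormal coordinates. The nodes will
  -- be its eigenvalues, the weights the squared components of the vector `u` of the constant 1 in
  -- an eigenbasis.
  set N : Matrix (Fin (t + 1)) (Fin (t + 1)) ℝ := Matrix.of fun i j => s (i + j + 1)
  set T := Bᵀ⁻¹ * N * B⁻¹ with hTdef
  have hT : T.IsHermitian := by
    have hN : Nᵀ = N := by ext i j; simp [N, add_comm]
    rw [IsHermitian, hTdef]
    simp [transpose_nonsing_inv, hN, mul_assoc]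
  set u := B *ᵥ Pi.single 0 1 with hu
  have hTB : T * B = Bᵀ⁻¹ * N := by rw [hTdef, nonsing_inv_mul_cancel_right _ _ hB]
  have hBM : Bᵀ⁻¹ * (Matrix.of fun i j : Fin (t + 1) => s (i + j)) = B := by
    rw [hMB, nonsing_inv_mul_cancel_left _ _ hBt]
  have hpow : ∀ k (hk : k < t + 1), (T ^ k) *ᵥ u = B *ᵥ Pi.single ⟨k, hk⟩ 1 := by
    intro k
    induction k with
    | zero => intro hk; simp [hu]
    | succ k ih =>
      intro hk
      rw [pow_succ', ← mulVec_mulVec, ih (by omega), mulVec_mulVec, hTB]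
      conv_rhs => rw [← hBM]
      rw [← mulVec_mulVec, ← mulVec_mulVec]
      congr 1
      ext i
      simp [N, add_assoc]
  obtain ⟨U, e, hUU, hUU', hspec⟩ : ∃ (U : Matrix (Fin (t + 1)) (Fin (t + 1)) ℝ)
      (e : Fin (t + 1) → ℝ), star U * U = 1 ∧ U * star U = 1 ∧ T = U * diagonal e * star U := by
    refine ⟨hT.eigenvectorUnitary.1, hT.eigenvalues, Unitary.coe_star_mul_self _,
      Unitary.coe_mul_star_self _, ?_⟩
    conv_lhs => rw [hT.spectral_theorem]
    rw [Unitary.conjStarAlgAut_apply]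
    rfl
  have hspecpow : ∀ k, T ^ k = U * diagonal (fun i => e i ^ k) * star U := by
    intro k
    induction k with
    | zero => simp [hUU']
    | succ k ih =>
      rw [pow_succ, ih]
      conv_lhs => rw [hspec]
      rw [show U * diagonal (fun i => e i ^ k) * star U *
        (U * diagonal e * star U) = U * (diagonal (fun i => e i ^ k) *
        (star U * U) * diagonal e) * star U by simp only [mul_assoc], hUU, mul_one,
        diagonal_mul_diagonal]
      simp [pow_succ]
  refine ⟨fun i => (star U *ᵥ u) i ^ 2, e, fun i => sq_nonneg _, fun k hk => ?_⟩
  -- Writing k as a sum of two exponents ≤ t reaches all moments up to 2t, although `hpow` covers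
  -- only powers up to t.
  have h1 : s k = (B *ᵥ Pi.single ⟨min k t, by omega⟩ 1) ⬝ᵥ
      (B *ᵥ Pi.single ⟨k - min k t, by omega⟩ 1) := by
    rw [dotProduct_mulVec, ← mulVec_transpose, mulVec_mulVec, ← hMB]
    simp
  have h2 : ∀ a b, (T ^ a *ᵥ u) ⬝ᵥ (T ^ b *ᵥ u) = u ⬝ᵥ (T ^ (a + b) *ᵥ u) := by
    intro a b
    have hTt : Tᵀ = T := by simpa [IsHermitian] using hT
    rw [pow_add, ← mulVec_mulVec, dotProduct_mulVec u, ← mulVec_transpose, transpose_pow, hTt]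
  rw [h1, ← hpow, ← hpow, h2, show min k t + (k - min k t) = k by omega, hspecpow,
    ← mulVec_mulVec, ← mulVec_mulVec, dotProduct_mulVec, ← mulVec_transpose]
  have hUt : Uᵀ = star U := by rw [star_eq_conjTranspose]; simp
  rw [hUt, dotProduct]
  refine Finset.sum_congr rfl fun i _ => ?_
  rw [mulVec_diagonal]
  ring

end Hankel

/-! ### Point evaluation and the lower bound on a cube. -/

section PointEvaluation

open Polynomial Polynomial.Chebyshev

theorem integrable_eval_measureT (P : ℝ[X]) : Integrable (fun x => P.eval x) measureT :=
  integrable_measureT P.continuous.continuousOn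

/-- The polynomial representing evaluation at `0` with respect to the Chebyshev weight. -/
noncomputable def chebyshevKernel (N : ℕ) : ℝ[X] :=
  ∑ i ∈ Finset.range N,
    Polynomial.C ((T ℝ i).eval 0 / if i = 0 then Real.pi else Real.pi / 2) * T ℝ i

theorem integral_mul_chebyshevKernel {N : ℕ} {P : ℝ[X]} (hP : P ∈ degreeLT ℝ N) :
    ∫ x, P.eval x * (chebyshevKernel N).eval x ∂measureT = P.eval 0 := by
  have hseq : ∀ i, (chebyshevTsequence ℝ) i = T ℝ (i : ℕ) := fun i => rfl
  rw [← (chebyshevTsequence ℝ).span_degreeLT fun i _ => by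
    simp [isUnit_iff_ne_zero, (chebyshevTsequence ℝ).ne_zero i]] at hP
  induction hP using Submodule.span_induction with
  | mem P hP =>
    obtain ⟨j, hj, rfl⟩ := hP
    rw [hseq]
    have hj' : j < N := hj
    have hterm : ∀ (i : ℕ) (a : ℝ), ∫ x, (T ℝ j).eval x * (Polynomial.C a * T ℝ i).eval x
        ∂measureT = a * ∫ x, (T ℝ j).eval x * (T ℝ i).eval x ∂measureT := fun i a => by
      rw [← integral_const_mul]
      refine integral_congr_ae (ae_of_all _ fun x => ?_)
      simp only [eval_mul, eval_C]
      ring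
    simp_rw [chebyshevKernel, eval_finsetSum, Finset.mul_sum]
    rw [integral_finsetSum]
    · rw [Finset.sum_eq_single j]
      · rw [hterm]
        have : ∫ x, (T ℝ j).eval x * (T ℝ j).eval x ∂measureT =
            if j = 0 then Real.pi else Real.pi / 2 := by
          split_ifs with h
          · subst h; exact integral_eval_T_real_mul_self_measureT_zero
          · exact integral_T_real_mul_self_measureT_of_ne_zero h
        rw [this, div_mul_cancel₀]
        split_ifs <;> positivity
      · intro i _ hij
        rw [hterm, integral_eval_T_real_mul_eval_T_real_measureT_of_ne hij.symm,
          mul_zero]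
      · simp [hj']
    · intro i _
      simpa using integrable_eval_measureT (T ℝ j *
        (Polynomial.C ((T ℝ i).eval 0 / if i = 0 then Real.pi else Real.pi / 2) * T ℝ i))
  | zero => simp
  | add P Q _ _ hP hQ =>
    simp_rw [eval_add, add_mul]
    rw [integral_add, hP, hQ]
    · simpa using integrable_eval_measureT (P * chebyshevKernel N)
    · simpa using integrable_eval_measureT (Q * chebyshevKernel N)
  | smul a P _ hP =>
    simp_rw [eval_smul, smul_eq_mul, mul_assoc]
    rw [integral_const_mul, hP]

theorem abs_eval_chebyshevKernel_le (N : ℕ) {u : ℝ} (hu : |u| ≤ 1) :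
    |(chebyshevKernel N).eval u| ≤ N := by
  rw [chebyshevKernel, eval_finsetSum]
  refine (Finset.abs_sum_le_sum_abs _ _).trans ?_
  have : ∀ i ∈ Finset.range N, |(Polynomial.C ((T ℝ i).eval 0 /
      if i = 0 then Real.pi else Real.pi / 2) * T ℝ i).eval u| ≤ 1 := by
    intro i _
    have h1 := abs_eval_T_real_le_one i hu
    have h2 := abs_eval_T_real_le_one i (x := 0) (by simp)
    have h3 : 1 ≤ if i = 0 then Real.pi else Real.pi / 2 := by
      have := Real.pi_gt_three
      split_ifs <;> linarith
    rw [eval_mul, eval_C, abs_mul, abs_div]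
    refine mul_le_one₀ ?_ (abs_nonneg _) h1
    rw [abs_of_nonneg (a := ite _ _ _) (by linarith)]
    exact div_le_one_of_le₀ (h2.trans h3) (by linarith)
  simpa using Finset.sum_le_sum this

/-- The Chebyshev weight is unbounded at ±1. Applying its kernel to q(u)(1 − u²), which has the same
value at 0 and degree at most t + 2, replaces the weight by √(1 − u²). -/
theorem exists_evaluation_kernel_unit (t : ℕ) : ∃ k : ℝ → ℝ, Continuous k ∧
    (∀ u, |u| ≤ 1 → |k u| ≤ t + 3) ∧
    ∀ q : ℝ[X], q.natDegree ≤ t → ∫ u in (-1)..1, q.eval u * k u = q.eval 0 := by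
  refine ⟨fun u => √(1 - u ^ 2) * (chebyshevKernel (t + 3)).eval u, by fun_prop, ?_, ?_⟩
  · intro u hu
    have h1 : √(1 - u ^ 2) ≤ 1 := Real.sqrt_le_one.2 (by nlinarith [sq_nonneg u])
    have h2 := abs_eval_chebyshevKernel_le (t + 3) hu
    push_cast at h2
    rw [abs_mul, abs_of_nonneg (Real.sqrt_nonneg _)]
    nlinarith [abs_nonneg ((chebyshevKernel (t + 3)).eval u)]
  · intro q hq
    have hdeg : q * (1 - X ^ 2) ∈ degreeLT ℝ (t + 3) := by
      rw [mem_degreeLT]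
      refine (degree_le_natDegree).trans_lt ?_
      have h1 : (1 - X ^ 2 : ℝ[X]).natDegree ≤ 2 := by compute_degree
      exact_mod_cast (natDegree_mul_le.trans (add_le_add hq h1)).trans_lt (by omega)
    have := integral_mul_chebyshevKernel hdeg
    rw [integral_measureT] at this
    simp only [eval_mul, eval_sub, eval_one, eval_pow, eval_X] at this
    rw [show q.eval 0 = q.eval 0 * (1 - 0 ^ 2) by ring, ← this]
    refine intervalIntegral.integral_congr fun u hu => ?_
    rw [Set.uIcc_of_le (by norm_num)] at hu
    have hu2 : 0 ≤ 1 - u ^ 2 := by nlinarith [hu.1, hu.2]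
    have hs : (1 - u ^ 2) * √(1 - u ^ 2)⁻¹ = √(1 - u ^ 2) := by
      rw [Real.sqrt_inv]
      nth_rewrite 1 [← Real.mul_self_sqrt hu2]
      exact mul_self_mul_inv _
    simp only
    rw [← hs]
    ring

theorem exists_evaluation_kernel (t : ℕ) (x : ℝ) {δ : ℝ} (hδ : 0 < δ) : ∃ k : ℝ → ℝ, Continuous k ∧
    (∀ u ∈ Set.Icc (x - δ) (x + δ), |k u| ≤ (t + 3) / δ) ∧
    ∀ q : ℝ[X], q.natDegree ≤ t →
      ∫ u in Set.Icc (x - δ) (x + δ), q.eval u * k u = q.eval x := by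
  obtain ⟨k, hk, hkb, hkr⟩ := exists_evaluation_kernel_unit t
  refine ⟨fun u => k ((u - x) / δ) / δ, by fun_prop, ?_, ?_⟩
  · intro u hu
    rw [abs_div, abs_of_pos hδ]
    gcongr
    refine hkb _ ?_
    rw [abs_div, abs_of_pos hδ]
    exact div_le_one_of_le₀ (abs_le.2 ⟨by linarith [hu.1], by linarith [hu.2]⟩) hδ.le
  · intro q hq
    have hd : (q.comp (Polynomial.C δ * X + Polynomial.C x)).natDegree ≤ t := by
      rw [natDegree_comp]
      calc _ ≤ t * 1 := Nat.mul_le_mul hq natDegree_linear_le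
        _ = t := mul_one t
    have h := hkr _ hd
    simp only [eval_comp, eval_add, eval_mul, eval_C, eval_X, mul_zero, zero_add] at h
    rw [integral_Icc_eq_integral_Ioc, ← intervalIntegral.integral_of_le (by linarith), ← h]
    have h2 := intervalIntegral.integral_comp_mul_add (a := -1) (b := 1)
      (fun u => q.eval u * k ((u - x) / δ)) hδ.ne' x
    have h3 : ∀ u : ℝ, (δ * u + x - x) / δ = u := fun u => by field_simp; ring
    simp only [h3] at h2
    rw [h2, smul_eq_mul, show δ * -1 + x = x - δ by ring, show δ * 1 + x = x + δ by ring,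
      ← intervalIntegral.integral_const_mul]
    exact intervalIntegral.integral_congr fun u _ => by simp only; ring

theorem MvPolynomial.apply_le_of_mem_support {σ : Type*}
    {p : MvPolynomial σ ℝ} {t : ℕ} (hp : p.totalDegree ≤ t) {d : σ →₀ ℕ} (hd : d ∈ p.support)
    (i : σ) : d i ≤ t :=
  (d.le_degree i).trans ((MvPolynomial.le_totalDegree hd).trans hp)

/-- The mean square of a polynomial over a cube, compared with its value at the centre. -/
theorem inv_le_integral_cube_sq {n : ℕ} (t : ℕ) (x : Fin n → ℝ) {δ : ℝ} (hδ : 0 < δ)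
    {p : MvPolynomial (Fin n) ℝ} (hp : p.totalDegree ≤ t) (hx : MvPolynomial.eval x p = 1) :
    (((t + 3) ^ 2 * (2 / δ)) ^ n)⁻¹ ≤ ∫ w, (MvPolynomial.eval w p) ^ 2
      ∂(Measure.pi fun i => volume.restrict (Set.Icc (x i - δ) (x i + δ))) := by
  set μ := Measure.pi fun i => (volume : Measure ℝ).restrict (Set.Icc (x i - δ) (x i + δ)) with hμ
  have hμr : μ = volume.restrict (Set.univ.pi fun i => Set.Icc (x i - δ) (x i + δ)) := by
    rw [hμ, volume_pi, Measure.restrict_pi_pi]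
  have hcomp : IsCompact (Set.univ.pi fun i => Set.Icc (x i - δ) (x i + δ)) :=
    isCompact_univ_pi fun i => isCompact_Icc
  have hint : ∀ {g : (Fin n → ℝ) → ℝ}, Continuous g → Integrable g μ := fun hg => by
    rw [hμr]; exact hg.continuousOn.integrableOn_compact hcomp
  choose k hk hkb hkr using fun i => exists_evaluation_kernel t (x i) hδ
  set h : (Fin n → ℝ) → ℝ := fun w => ∏ i, k i (w i)
  have hhc : Continuous h := by fun_prop
  have hpc : Continuous fun w : Fin n → ℝ => MvPolynomial.eval w p :=
    MvPolynomial.continuous_eval p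
  have hrep : ∫ w, MvPolynomial.eval w p * h w ∂μ = 1 := by
    rw [← hx]
    simp_rw [MvPolynomial.eval_eq', Finset.sum_mul]
    rw [integral_finsetSum _ fun d _ => hint (by fun_prop)]
    refine Finset.sum_congr rfl fun d hd => ?_
    simp_rw [mul_assoc]
    rw [integral_const_mul]
    congr 1
    simp_rw [h, ← Finset.prod_mul_distrib]
    rw [hμ, integral_fintype_prod_eq_prod (fun i u => u ^ d i * k i u)]
    refine Finset.prod_congr rfl fun i _ => ?_
    simpa using hkr i (X ^ d i) (by
      simpa using MvPolynomial.apply_le_of_mem_support hp hd i)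
  -- The squared sup bound ((t+3)/δ)^(2n) of `h` times the volume (2δ)^n of the cube.
  set B : ℝ := ((t + 3) ^ 2 * (2 / δ)) ^ n
  have hB : 0 < B := by positivity
  have hh2 : ∫ w, h w ^ 2 ∂μ ≤ B := by
    have hb : ∀ᵐ w ∂μ, ‖h w ^ 2‖ ≤ (((t + 3) / δ) ^ n) ^ 2 := by
      rw [hμr]
      filter_upwards [ae_restrict_mem hcomp.measurableSet] with w hw
      rw [norm_pow, Real.norm_eq_abs, Finset.abs_prod]
      gcongr
      calc ∏ i, |k i (w i)| ≤ ∏ i : Fin n, ((t + 3) / δ : ℝ) :=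
            Finset.prod_le_prod (fun i _ => abs_nonneg _)
              fun i _ => hkb i _ (hw i (Set.mem_univ i))
        _ = _ := by rw [Finset.prod_const, Finset.card_univ, Fintype.card_fin]
    have hvol : μ.real Set.univ = (2 * δ) ^ n := by
      rw [hμ, measureReal_def, Measure.pi_univ]
      simp only [Measure.restrict_apply_univ, Real.volume_Icc, ENNReal.toReal_prod]
      simp only [show ∀ a : ℝ, a + δ - (a - δ) = 2 * δ by intro a; ring,
        ENNReal.toReal_ofReal (show 0 ≤ 2 * δ by positivity)]
      simp
    refine (le_abs_self _).trans ((norm_integral_le_of_norm_le_const hb).trans_eq ?_)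
    rw [hvol, ← pow_mul, mul_comm n 2, pow_mul, ← mul_pow]
    congr 1
    field_simp
  -- Cauchy–Schwarz in the form 2ph/B ≤ p² + h²/B²: the integral of p² is at least 2/B − 1/B.
  have hmono : ∫ w, 2 * B⁻¹ * (MvPolynomial.eval w p * h w) ∂μ ≤
      ∫ w, ((MvPolynomial.eval w p) ^ 2 + B⁻¹ ^ 2 * h w ^ 2) ∂μ :=
    integral_mono (hint (by fun_prop)) (hint (by fun_prop)) fun w => by
      simp only
      nlinarith [sq_nonneg (MvPolynomial.eval w p - B⁻¹ * h w)]
  rw [integral_const_mul, hrep, integral_add (hint (by fun_prop)) (hint (by fun_prop)),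
    integral_const_mul] at hmono
  have : B⁻¹ ^ 2 * ∫ w, h w ^ 2 ∂μ ≤ B⁻¹ := by
    calc _ ≤ B⁻¹ ^ 2 * B := by gcongr
      _ = B⁻¹ := by field_simp
  linarith

end PointEvaluation

/-! ### Monomial bases. -/

section Monomials

variable {E σ : Type*} [Fintype σ]

/-- The exponents of the monomials of total degree at most `t`. -/
abbrev MonomialIndex (σ : Type*) (t : ℕ) := {d : σ →₀ ℕ // d.degree ≤ t}

noncomputable instance (t : ℕ) : Fintype (MonomialIndex σ t) :=
  (Finsupp.finite_of_degree_le t).fintype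

/-- The monomial functions in the coordinates `c`. -/
def monomialFun (c : E → σ → ℝ) (t : ℕ) (d : MonomialIndex σ t) (w : E) : ℝ :=
  ∏ i, c w i ^ d.1 i

theorem eval_eq_sum_monomialFun (c : E → σ → ℝ) {t : ℕ} {p : MvPolynomial σ ℝ}
    (hp : p.totalDegree ≤ t) (w : E) :
    MvPolynomial.eval (c w) p = ∑ d : MonomialIndex σ t, p.coeff d.1 * monomialFun c t d w := by
  classical
  rw [MvPolynomial.eval_eq']
  have hsub : p.support ⊆ (Finsupp.finite_of_degree_le (σ := σ) t).toFinset := fun d hd =>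
    (Set.Finite.mem_toFinset _).2 ((MvPolynomial.le_totalDegree hd).trans hp)
  rw [Finset.sum_subset hsub fun d _ hd => by simp [MvPolynomial.notMem_support_iff.1 hd]]
  exact Finset.sum_subtype _ (fun d => by simp) _

theorem sum_monomial_totalDegree_le {t : ℕ} (a : MonomialIndex σ t → ℝ) :
    (∑ d, MvPolynomial.monomial d.1 (a d)).totalDegree ≤ t := by
  refine MvPolynomial.totalDegree_finsetSum_le fun d _ => ?_
  exact (MvPolynomial.totalDegree_monomial_le _ _).trans d.2

theorem eval_sum_monomial (c : E → σ → ℝ) {t : ℕ} (a : MonomialIndex σ t → ℝ) (w : E) :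
    MvPolynomial.eval (c w) (∑ d, MvPolynomial.monomial d.1 (a d)) =
      ∑ d, a d * monomialFun c t d w := by
  simp [map_sum, MvPolynomial.eval_monomial, monomialFun, Finsupp.prod_fintype]

theorem coeff_sum_monomial {t : ℕ} (a : MonomialIndex σ t → ℝ) (d : MonomialIndex σ t) :
    (∑ e : MonomialIndex σ t, MvPolynomial.monomial e.1 (a e)).coeff d.1 = a d := by
  classical
  rw [MvPolynomial.coeff_sum, Finset.sum_eq_single d]
  · simp
  · intro e _ he
    rw [MvPolynomial.coeff_monomial, if_neg fun h => he (Subtype.ext h)]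
  · simp

open Matrix in
theorem christoffel_eq_inv_monomialFun [MeasurableSpace E] (c : E → σ → ℝ) (m : Measure E) (t : ℕ)
    (z : E) [DecidableEq (MonomialIndex σ t)]
    (hint : ∀ i j, Integrable (fun w => monomialFun c t i w * monomialFun c t j w) m)
    (hM : (momentMatrix m (monomialFun c t)).PosDef) :
    0 < (fun i => monomialFun c t i z) ⬝ᵥ
      ((momentMatrix m (monomialFun c t))⁻¹ *ᵥ fun i => monomialFun c t i z) ∧
    christoffel c m t z = ((fun i => monomialFun c t i z) ⬝ᵥ
      ((momentMatrix m (monomialFun c t))⁻¹ *ᵥ fun i => monomialFun c t i z))⁻¹ :=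
  christoffel_eq_inv c m t z (monomialFun c t)
    (fun _ hp => ⟨_, eval_eq_sum_monomialFun c hp⟩)
    (fun a => ⟨_, sum_monomial_totalDegree_le a, eval_sum_monomial c a⟩) hint hM

end Monomials

/-! ### Univariate Christoffel functions. -/

section Univariate

open Matrix

theorem christoffelY_eq_inv (ν : Measure ℝ) (t : ℕ) (s : ℕ → ℝ)
    (hint : ∀ k ≤ 2 * t, Integrable (fun z : ℝ => z ^ k) ν)
    (hs : ∀ k ≤ 2 * t, ∫ z, z ^ k ∂ν = s k)
    (hM : (Matrix.of fun i j : Fin (t + 1) => s (i + j)).PosDef) (z : ℝ) :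
    christoffelY ν t z = (monomialVec t z ⬝ᵥ
      ((Matrix.of fun i j : Fin (t + 1) => s (i + j))⁻¹ *ᵥ monomialVec t z))⁻¹ := by
  have hmm : momentMatrix ν (fun (i : Fin (t + 1)) (w : ℝ) => w ^ (i : ℕ)) =
      Matrix.of fun i j : Fin (t + 1) => s (i + j) := by
    ext i j
    simp only [momentMatrix, of_apply, ← pow_add]
    exact hs _ (by omega)
  have := (christoffel_eq_inv (σ := Fin 1) (fun w => fun _ => w) ν t z
    (fun (i : Fin (t + 1)) (w : ℝ) => w ^ (i : ℕ)) ?_ ?_ ?_ (by rw [hmm]; exact hM)).2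
  · rw [hmm] at this
    exact this
  · intro p hp
    set P : Polynomial ℝ := MvPolynomial.aeval (fun _ => Polynomial.X) p with hP
    have hdeg : P.natDegree < t + 1 := by
      have := MvPolynomial.aeval_natDegree_le p hp (fun _ : Fin 1 => (Polynomial.X : Polynomial ℝ))
        (n := 1) (fun _ => Polynomial.natDegree_X_le)
      rw [mul_one] at this
      exact Nat.lt_succ_of_le this
    refine ⟨fun i => P.coeff i, fun w => ?_⟩
    have he : MvPolynomial.eval (fun _ => w) p = P.eval w := by
      rw [hP, ← Polynomial.coe_evalRingHom, MvPolynomial.aeval_def, MvPolynomial.hom_eval₂,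
        MvPolynomial.eval, MvPolynomial.coe_eval₂Hom]
      congr 1
      · ext; simp
      · ext; simp
    rw [he, Polynomial.eval_eq_sum_range' hdeg, Finset.sum_range]
  · intro a
    refine ⟨∑ i : Fin (t + 1), MvPolynomial.C (a i) * MvPolynomial.X 0 ^ (i : ℕ), ?_, by simp⟩
    refine MvPolynomial.totalDegree_finsetSum_le fun i _ => ?_
    refine (MvPolynomial.totalDegree_mul _ _).trans ?_
    simp
    omega
  · intro i j
    simp only [← pow_add]
    exact hint _ (by omega)

/-- Every positive definite Gram matrix of a univariate polynomial arises, as far as the values of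
the polynomial are concerned, from the Christoffel function of a measure. -/
theorem exists_measure_christoffelY_eq_inv {t : ℕ} {Q : Matrix (Fin (t + 1)) (Fin (t + 1)) ℝ}
    (hQ : Q.PosDef) : ∃ ν : Measure ℝ, (∀ k ≤ 2 * t, Integrable (fun z : ℝ => z ^ k) ν) ∧
      ∀ z, christoffelY ν t z = (monomialVec t z ⬝ᵥ (Q *ᵥ monomialVec t z))⁻¹ := by
  obtain ⟨s, hs, hsQ⟩ := hQ.exists_hankel_inv
  obtain ⟨w, x, hw, hwx⟩ := exists_quadrature_of_hankel_posDef hs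
  set ν : Measure ℝ := ∑ i, ENNReal.ofReal (w i) • Measure.dirac (x i) with hν
  have hint : ∀ f : ℝ → ℝ, ∀ i ∈ Finset.univ,
      Integrable f (ENNReal.ofReal (w i) • Measure.dirac (x i)) := fun f i _ =>
    (integrable_dirac (by simp)).smul_measure ENNReal.ofReal_ne_top
  have hintν : ∀ f : ℝ → ℝ, Integrable f ν := fun f => integrable_finsetSum_measure.2 (hint f)
  refine ⟨ν, fun k _ => hintν _, fun z => ?_⟩
  rw [christoffelY_eq_inv ν t s (fun k _ => hintν _) (fun k hk => ?_) hs, hsQ]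
  rw [hwx k hk, hν, integral_finsetSum_measure (hint _)]
  simp [integral_smul_measure, ENNReal.toReal_ofReal (hw _)]

end Univariate

/-! ### Needle polynomials. -/

section Needle

theorem exists_needle {E σ : Type*} [TopologicalSpace E] [Fintype σ] {c : E → σ → ℝ}
    (hc : Continuous c) (hinj : Function.Injective c) {K : Set E} (hK : IsCompact K) {z : E}
    (hz : z ∉ K) : ∃ (q : MvPolynomial σ ℝ) (ρ : ℝ), q.totalDegree ≤ 2 ∧
      MvPolynomial.eval (c z) q = 1 ∧ 0 < ρ ∧ ρ < 1 ∧
      ∀ w ∈ K, |MvPolynomial.eval (c w) q| ≤ ρ := by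
  set D : E → ℝ := fun w => ∑ i, (c w i - c z i) ^ 2 with hD
  have hDc : Continuous D := by fun_prop
  have hDpos : ∀ w ∈ K, 0 < D w := by
    intro w hw
    refine (Finset.sum_nonneg fun i _ => sq_nonneg _).lt_of_ne fun h => hz ?_
    have h0 := (Finset.sum_eq_zero_iff_of_nonneg fun i _ => sq_nonneg (c w i - c z i)).1 h.symm
    have : w = z := hinj <| funext fun i => by
      simpa [sub_eq_zero] using h0 i (Finset.mem_univ i)
    rwa [← this]
  obtain ⟨d, hd, hdK⟩ := hK.exists_forall_le' hDc.continuousOn hDpos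
  obtain ⟨C, hC⟩ := hK.exists_bound_of_continuousOn hDc.continuousOn
  -- `R` exceeds max D on `K`, so 1 − D/R is nonnegative there, and exceeds `d`, so 1 − d/R is
  -- positive.
  set R := |C| + d + 1 with hR
  have hRpos : 0 < R := by positivity
  refine ⟨1 - MvPolynomial.C R⁻¹ * ∑ i, (MvPolynomial.X i - MvPolynomial.C (c z i)) ^ 2,
    1 - d / R, ?_, by simp, ?_, ?_, ?_⟩
  · refine (MvPolynomial.totalDegree_sub _ _).trans (max_le (by simp) ?_)
    refine (MvPolynomial.totalDegree_mul _ _).trans ?_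
    rw [MvPolynomial.totalDegree_C, zero_add]
    refine MvPolynomial.totalDegree_finsetSum_le fun i _ => ?_
    refine (MvPolynomial.totalDegree_pow _ _).trans ?_
    have := (MvPolynomial.totalDegree_sub_C_le (MvPolynomial.X (R := ℝ) i) (c z i))
    rw [MvPolynomial.totalDegree_X] at this
    omega
  · rw [sub_pos, div_lt_one hRpos]
    linarith [abs_nonneg C]
  · linarith [div_pos hd hRpos]
  · intro w hw
    have he : MvPolynomial.eval (c w) (1 - MvPolynomial.C R⁻¹ *
        ∑ i, (MvPolynomial.X i - MvPolynomial.C (c z i)) ^ 2) = 1 - D w / R := by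
      simp [hD]; ring
    have h1 : D w ≤ R := by
      have := (le_abs_self _).trans (hC w hw)
      linarith [le_abs_self C]
    have h2 : D w / R ≤ 1 := div_le_one_of_le₀ h1 hRpos.le
    have h3 : d / R ≤ D w / R := by gcongr; exact hdK w hw
    rw [he, abs_of_nonneg (by linarith)]
    linarith

end Needle

/-! ### Absorbing polynomial factors. -/

section Decay

/-- Split ρ^t = √ρ^t · √ρ^t: one factor absorbs the polynomial, the other remains as the rate. -/
theorem decaysExponentially_of_le {a : ℕ → ℝ} (ha : ∀ t, 0 ≤ a t) {C ρ : ℝ} {k : ℕ} (hρ : 0 < ρ)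
    (hρ1 : ρ < 1) (h : ∀ t : ℕ, a t ≤ C * (t + 3) ^ k * ρ ^ t) : DecaysExponentially a := by
  have hr : √ρ < 1 := by rw [Real.sqrt_lt' one_pos]; simpa
  have hr0 : 0 < √ρ := Real.sqrt_pos.2 hρ
  obtain ⟨B, hB⟩ := (tendsto_pow_const_mul_const_pow_of_abs_lt_one k
    (by rwa [abs_of_pos hr0])).bddAbove_range
  have hB' : ∀ t : ℕ, ((t : ℝ) + 3) ^ k * √ρ ^ t ≤ B / √ρ ^ 3 := fun t => by
    rw [le_div_iff₀ (by positivity), mul_assoc, ← pow_add]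
    exact_mod_cast hB ⟨t + 3, rfl⟩
  have hBpos : 0 ≤ B / √ρ ^ 3 := le_trans (by positivity) (hB' 0)
  refine ⟨|C| * (B / √ρ ^ 3) + 1, √ρ, by positivity, hr0, hr, fun t => ?_⟩
  rw [abs_of_nonneg (ha t)]
  calc a t ≤ C * (t + 3) ^ k * ρ ^ t := h t
    _ ≤ |C| * (t + 3) ^ k * ρ ^ t := by gcongr; exact le_abs_self C
    _ = |C| * ((t + 3) ^ k * √ρ ^ t) * √ρ ^ t := by
      conv_lhs => rw [← Real.mul_self_sqrt hρ.le, mul_pow]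
      ring
    _ ≤ |C| * (B / √ρ ^ 3) * √ρ ^ t := by gcongr; exact hB' t
    _ ≤ _ := by gcongr; linarith

end Decay

/-! ### Measures with density bounded below. -/

section ProductDomain

variable {n : ℕ} {X : Set (Fin n → ℝ)} {Y : Set ℝ} {μ : Measure ((Fin n → ℝ) × ℝ)}

theorem smul_restrict_le_withDensity {α : Type*} [MeasurableSpace α] {ν : Measure α} {Ω : Set α}
    (hΩ : MeasurableSet Ω) {f : α → ℝ≥0} {c : ℝ≥0} (hf : ∀ z ∈ Ω, c ≤ f z) :
    c • ν.restrict Ω ≤ ν.withDensity fun z => (f z : ℝ≥0∞) := by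
  refine Measure.le_iff.2 fun s hs => ?_
  rw [withDensity_apply _ hs, Measure.smul_apply, Measure.restrict_apply hs]
  calc c • ν (s ∩ Ω) = ∫⁻ _ in s ∩ Ω, c ∂ν := by simp [ENNReal.smul_def]
    _ ≤ ∫⁻ z in s ∩ Ω, f z ∂ν :=
      setLIntegral_mono' (hs.inter hΩ) fun z hz => by exact_mod_cast hf z hz.2
    _ ≤ ∫⁻ z in s, f z ∂ν := lintegral_mono_set Set.inter_subset_left

theorem smul_restrict_le_fst (c : ℝ≥0) (h : c • volume.restrict (X ×ˢ Y) ≤ μ) :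
    (c • volume Y) • volume.restrict X ≤ μ.fst := by
  have h1 := Measure.map_mono h measurable_fst
  rwa [Measure.map_smul, Measure.volume_eq_prod, ← Measure.prod_restrict, Measure.map_fst_prod,
    Measure.restrict_apply_univ, ← smul_assoc] at h1

theorem integrable_of_continuous_of_compact {α : Type*} [TopologicalSpace α] [MeasurableSpace α]
    [OpensMeasurableSpace α] [T2Space α] {m : Measure α} [IsFiniteMeasure m] {K : Set α}
    (hK : IsCompact K) (hm : m Kᶜ = 0) {g : α → ℝ} (hg : Continuous g) : Integrable g m := by
  have hr : m.restrict K = m := Measure.restrict_eq_self_of_ae_mem (mem_ae_iff.2 hm)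
  rw [← hr]
  exact hg.continuousOn.integrableOn_compact hK

/-- At an interior point of the support, the Christoffel function of a measure whose density is
bounded below decays at most polynomially. -/
theorem exists_le_christoffelX {φ : Measure (Fin n → ℝ)} [IsFiniteMeasure φ] (hX : IsCompact X)
    (hφX : φ Xᶜ = 0) {a : ℝ≥0∞} (ha : a ≠ 0) (hφ : a • volume.restrict X ≤ φ)
    {x : Fin n → ℝ} (hx : x ∈ interior X) :
    ∃ b : ℝ, 0 < b ∧ ∀ t : ℕ, b * ((t + 3 : ℝ) ^ (2 * n))⁻¹ ≤ christoffelX φ t x := by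
  obtain ⟨δ, hδ, hball⟩ := Metric.nhds_basis_closedBall.mem_iff.1 (mem_interior_iff_mem_nhds.1 hx)
  have hbox : (Set.univ.pi fun i => Set.Icc (x i - δ) (x i + δ)) ⊆ X := by
    refine Set.Subset.trans (fun w hw => ?_) hball
    rw [closedBall_pi _ hδ.le]
    intro i hi
    exact (Real.closedBall_eq_Icc (x := x i) (r := δ)).symm.subset (hw i hi)
  -- `a` may be `∞`, whose `toReal` is 0, so a finite positive minorant is used.
  obtain ⟨a', ha'0, ha'a⟩ : ∃ a' : ℝ≥0, 0 < a' ∧ (a' : ℝ≥0∞) ≤ a := by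
    obtain ⟨r, hr0, hr⟩ := ENNReal.lt_iff_exists_nnreal_btwn.1 (pos_iff_ne_zero.2 ha)
    exact ⟨r, by exact_mod_cast hr0, hr.le⟩
  have hle : (a' : ℝ≥0∞) •
      Measure.pi (fun i => volume.restrict (Set.Icc (x i - δ) (x i + δ))) ≤ φ := by
    rw [← Measure.restrict_pi_pi, ← volume_pi]
    refine le_trans (Measure.le_iff.2 fun s _ => ?_) hφ
    rw [Measure.smul_apply, Measure.smul_apply]
    exact mul_le_mul' ha'a (Measure.restrict_mono hbox le_rfl s)
  refine ⟨a' * ((2 / δ) ^ n)⁻¹, by positivity, fun t => ?_⟩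
  refine le_christoffel (fun w : Fin n → ℝ => w) φ fun p hp hpx => ?_
  have h1 := inv_le_integral_cube_sq t x hδ hp hpx
  have h2 := integral_mono_measure hle (f := fun w => (MvPolynomial.eval w p) ^ 2)
    (ae_of_all _ fun w => sq_nonneg _)
    (integrable_of_continuous_of_compact hX hφX ((MvPolynomial.continuous_eval p).pow 2))
  rw [integral_smul_measure] at h2
  refine le_trans ?_ h2
  rw [mul_pow, ← pow_mul, mul_inv] at h1
  calc _ = (a' : ℝ) * (((t + 3 : ℝ) ^ (2 * n))⁻¹ * ((2 / δ) ^ n)⁻¹) := by ring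
    _ ≤ _ := by
      simp only [ENNReal.coe_toReal, smul_eq_mul]
      gcongr

/-- The real coordinates on `ℝⁿ × ℝ`. -/
def coordXY (n : ℕ) (w : (Fin n → ℝ) × ℝ) : Fin n ⊕ Fin 1 → ℝ := Sum.elim w.1 fun _ => w.2

theorem continuous_coordXY (n : ℕ) : Continuous (coordXY n) := by
  refine continuous_pi fun i => ?_
  rcases i with i | i
  · exact (continuous_apply i).comp continuous_fst
  · exact continuous_snd

theorem coordXY_injective (n : ℕ) : Function.Injective (coordXY n) := fun _ _ h =>
  Prod.ext (funext fun i => congrFun h (.inl i)) (congrFun h (.inr 0))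

theorem continuous_eval_coordXY (p : MvPolynomial (Fin n ⊕ Fin 1) ℝ) :
    Continuous fun w => MvPolynomial.eval (coordXY n w) p :=
  (MvPolynomial.continuous_eval p).comp (continuous_coordXY n)

theorem continuous_monomialFun_coordXY (t : ℕ) (d : MonomialIndex (Fin n ⊕ Fin 1) t) :
    Continuous (monomialFun (coordXY n) t d) :=
  continuous_finsetProd _ fun i _ =>
    ((continuous_apply i).comp (continuous_coordXY n)).pow _

theorem MvPolynomial.eq_zero_of_eqOn_open {U : Set ((Fin n → ℝ) × ℝ)} (hU : IsOpen U)
    (hne : U.Nonempty) {p : MvPolynomial (Fin n ⊕ Fin 1) ℝ}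
    (h : ∀ w ∈ U, MvPolynomial.eval (coordXY n w) p = 0) : p = 0 := by
  obtain ⟨⟨x, y⟩, hxy⟩ := hne
  obtain ⟨δ, hδ, hball⟩ := Metric.isOpen_iff.1 hU _ hxy
  refine MvPolynomial.funext_set (fun i => Set.Ioo (coordXY n (x, y) i - δ)
    (coordXY n (x, y) i + δ)) (fun i => Set.Ioo_infinite (by linarith)) fun u hu => ?_
  have hu' : ∀ i, dist (u i) (coordXY n (x, y) i) < δ := fun i => by
    rw [← Metric.mem_ball, Real.ball_eq_Ioo]
    exact hu i (Set.mem_univ i)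
  have hmem : (fun i => u (.inl i), u (.inr 0)) ∈ U := hball <| by
    rw [Metric.mem_ball, Prod.dist_eq, max_lt_iff]
    exact ⟨(dist_pi_lt_iff hδ).2 fun i => hu' (.inl i), hu' (.inr 0)⟩
  have hcoord : coordXY n (fun i => u (.inl i), u (.inr 0)) = u := by
    ext i
    rcases i with i | i
    · rfl
    · simp [coordXY, Subsingleton.elim i 0]
  rw [map_zero, ← hcoord]
  exact h _ hmem

/-- The quadratic form is ∫p² dμ. If it vanishes, p = 0 Lebesgue-almost everywhere on the interior
of `Ω`, hence throughout it by continuity, and so identically. -/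
theorem momentMatrix_monomialFun_posDef {Ω : Set ((Fin n → ℝ) × ℝ)} [IsFiniteMeasure μ]
    (hΩ : IsCompact Ω) (hne : (interior Ω).Nonempty) (hμΩ : μ Ωᶜ = 0)
    {c : ℝ≥0} (hc : 0 < c) (hμ : c • volume.restrict Ω ≤ μ) (t : ℕ) :
    (momentMatrix μ (monomialFun (coordXY n) t)).PosDef := by
  have hint : ∀ {g : (Fin n → ℝ) × ℝ → ℝ}, Continuous g → Integrable g μ := fun hg =>
    integrable_of_continuous_of_compact hΩ hμΩ hg
  refine Matrix.PosDef.of_dotProduct_mulVec_pos (momentMatrix_isHermitian _ _) fun a ha => ?_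
  rw [star_trivial, ← integral_sq_sum_eq μ _ fun i j =>
    hint ((continuous_monomialFun_coordXY t i).mul (continuous_monomialFun_coordXY t j))]
  simp_rw [← eval_sum_monomial]
  set p := ∑ d : MonomialIndex (Fin n ⊕ Fin 1) t, MvPolynomial.monomial d.1 (a d) with hp
  refine (integral_nonneg fun w => sq_nonneg _).lt_of_ne fun h0 => ha ?_
  rw [eq_comm, integral_eq_zero_iff_of_nonneg (fun w => sq_nonneg _)
    (hint ((continuous_eval_coordXY p).pow 2))] at h0
  have hac : volume.restrict (interior Ω) ≪ μ := by
    refine (Measure.restrict_mono interior_subset le_rfl).absolutelyContinuous.trans ?_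
    refine Measure.AbsolutelyContinuous.trans ?_ hμ.absolutelyContinuous
    exact Measure.absolutelyContinuous_smul (c := (c : ℝ≥0∞)) (by exact_mod_cast hc.ne')
  have hon := Measure.eqOn_open_of_ae_eq (hac.ae_le h0) isOpen_interior
    ((continuous_eval_coordXY p).pow 2).continuousOn continuousOn_const
  have hp0 : p = 0 := MvPolynomial.eq_zero_of_eqOn_open isOpen_interior hne fun w hw => by
    simpa using hon hw
  ext d
  rw [← coeff_sum_monomial a d, ← hp, hp0]
  simp

end ProductDomain

/-! ### Restriction to the fibre over `x` and existence of ν. -/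

section Slice

open Matrix

variable {n : ℕ}

/-- The matrix expressing the monomials in `(x, z)` through the powers of `z`. -/
def sliceMatrix (x : Fin n → ℝ) (t : ℕ) :
    Matrix (MonomialIndex (Fin n ⊕ Fin 1) t) (Fin (t + 1)) ℝ :=
  Matrix.of fun d k => if (k : ℕ) = d.1 (.inr 0) then ∏ i, x i ^ d.1 (.inl i) else 0

theorem sliceMatrix_mulVec_monomialVec (x : Fin n → ℝ) (t : ℕ) (z : ℝ) :
    sliceMatrix x t *ᵥ monomialVec t z = fun d => monomialFun (coordXY n) t d (x, z) := by
  ext d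
  have hd : d.1 (.inr 0) < t + 1 := Nat.lt_succ_of_le ((d.1.le_degree _).trans d.2)
  rw [mulVec, dotProduct, Finset.sum_eq_single ⟨d.1 (.inr 0), hd⟩]
  · simp [sliceMatrix, monomialVec, monomialFun, coordXY]
  · intro k _ hk
    have hk' : (k : ℕ) ≠ d.1 (.inr 0) := fun h => hk (Fin.ext h)
    simp [sliceMatrix, hk']
  · simp

/-- The rows indexed by the pure powers of z form an identity matrix. -/
theorem sliceMatrix_mulVec_injective (x : Fin n → ℝ) (t : ℕ) :
    Function.Injective (sliceMatrix x t).mulVec := by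
  intro u v huv
  ext k
  have hdeg : (Finsupp.single (.inr 0 : Fin n ⊕ Fin 1) (k : ℕ)).degree ≤ t := by
    rw [Finsupp.degree_single]; omega
  have happ : ∀ u : Fin (t + 1) → ℝ, (sliceMatrix x t *ᵥ u)
      ⟨Finsupp.single (.inr 0) (k : ℕ), hdeg⟩ = u k := by
    intro u
    rw [mulVec, dotProduct, Finset.sum_eq_single k]
    · simp [sliceMatrix]
    · intro l _ hl
      simp [sliceMatrix, Fin.val_ne_of_ne hl]
    · simp
  rw [← happ u, ← happ v]
  exact congrFun huv _

/-- Λ^φ_t(x)/Λ^μ_t(x,z) has the Gram matrix Λ^φ_t(x) SᵀM⁻¹S in the powers of z, positive definite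
because S is injective. -/
theorem exists_isChristoffelDisintegration {μ : Measure ((Fin n → ℝ) × ℝ)} {x : Fin n → ℝ} {t : ℕ}
    (hint : ∀ i j, Integrable
      (fun w => monomialFun (coordXY n) t i w * monomialFun (coordXY n) t j w) μ)
    (hM : (momentMatrix μ (monomialFun (coordXY n) t)).PosDef)
    (hφ : 0 < christoffelX μ.fst t x) : ∃ ν : Measure ℝ, IsChristoffelDisintegration μ x t ν := by
  classical
  set M := momentMatrix μ (monomialFun (coordXY n) t) with hMdef
  set S := sliceMatrix x t
  have hQ : (christoffelX μ.fst t x • (Sᵀ * M⁻¹ * S)).PosDef := by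
    refine PosDef.smul ?_ hφ
    simpa using hM.inv.conjTranspose_mul_mul_same (sliceMatrix_mulVec_injective x t)
  obtain ⟨ν, hν, hνz⟩ := exists_measure_christoffelY_eq_inv hQ
  refine ⟨ν, hν, fun z => ?_⟩
  have h1 := (christoffel_eq_inv_monomialFun (coordXY n) μ t (x, z) hint hM).2
  rw [← sliceMatrix_mulVec_monomialVec, ← hMdef] at h1
  rw [hνz, smul_mulVec, dotProduct_smul, smul_eq_mul, mul_inv, mul_inv_cancel_left₀ hφ.ne',
    ← mulVec_mulVec, ← mulVec_mulVec, dotProduct_mulVec, vecMul_transpose]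
  exact h1

end Slice

/-! ### The corollary. -/

theorem corollary3p2 (n : ℕ) (X : Set (Fin n → ℝ)) (Y : Set ℝ)
    (hcompact : IsCompact (X ×ˢ Y))
    (hne : (interior (X ×ˢ Y)).Nonempty)
    (hΩ : X ×ˢ Y = closure (interior (X ×ˢ Y)))
    (hX : X = closure (interior X))
    (μ : Measure ((Fin n → ℝ) × ℝ)) [IsFiniteMeasure μ]
    (hμΩ : μ (X ×ˢ Y)ᶜ = 0)
    (f : (Fin n → ℝ) × ℝ → ℝ≥0) (hf : Measurable f)
    (hμf : μ = volume.withDensity (fun z => (f z : ℝ≥0∞)))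
    (hfpos : ∃ c : ℝ≥0, 0 < c ∧ ∀ z ∈ X ×ˢ Y, c ≤ f z)
    (x : Fin n → ℝ) (hx : x ∈ interior X) (y : ℝ) (hxy : (x, y) ∉ X ×ˢ Y) :
    (∀ t : ℕ, ∃ ν : Measure ℝ, IsChristoffelDisintegration μ x t ν) ∧
    (∀ ν : ℕ → Measure ℝ, (∀ t : ℕ, IsChristoffelDisintegration μ x t (ν t)) →
      (∀ t : ℕ, 0 < christoffelY (ν t) t y) ∧
      DecaysExponentially (fun t => christoffelY (ν t) t y)) ∧
    (∀ κ : Kernel (Fin n → ℝ) ℝ, IsConditional μ X Y κ →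
      Antitone (fun t => christoffelY (κ x) t y) ∧
      DecaysExponentially (fun t => christoffelY (κ x) t y)) := by
  classical
  obtain ⟨c, hc, hcf⟩ := hfpos
  obtain ⟨⟨x₀, y₀⟩, h₀⟩ := hne
  have hne : (interior (X ×ˢ Y)).Nonempty := ⟨_, h₀⟩
  have hxX : x ∈ X := interior_subset hx
  have hy : y ∉ Y := fun hy => hxy ⟨hxX, hy⟩
  have hXc : IsCompact X := by
    rw [← Set.fst_image_prod X ⟨y₀, (interior_subset h₀).2⟩]
    exact hcompact.image continuous_fst
  have hYc : IsCompact Y := by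
    rw [← Set.snd_image_prod ⟨x, hxX⟩ Y]
    exact hcompact.image continuous_snd
  have hle : c • volume.restrict (X ×ˢ Y) ≤ μ := by
    rw [hμf]
    exact smul_restrict_le_withDensity hcompact.measurableSet hcf
  have hint : ∀ {g : (Fin n → ℝ) × ℝ → ℝ}, Continuous g → Integrable g μ := fun hg =>
    integrable_of_continuous_of_compact hcompact hμΩ hg
  have hintm : ∀ t, ∀ i j, Integrable
      (fun w => monomialFun (coordXY n) t i w * monomialFun (coordXY n) t j w) μ := fun t i j =>
    hint ((continuous_monomialFun_coordXY t i).mul (continuous_monomialFun_coordXY t j))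
  have hpd := momentMatrix_monomialFun_posDef hcompact hne hμΩ hc hle
  have hfstX : μ.fst Xᶜ = 0 := by
    rw [Measure.fst_apply hXc.measurableSet.compl]
    exact measure_mono_null (t := (X ×ˢ Y)ᶜ) (fun w hw h => hw h.1) hμΩ
  have hYpos : c • volume Y ≠ 0 := by
    rw [interior_prod_eq] at h₀
    have : volume Y ≠ 0 := (Measure.measure_pos_of_mem_nhds volume
      (mem_interior_iff_mem_nhds.1 h₀.2)).ne'
    simp [ENNReal.smul_def, hc.ne', this]
  obtain ⟨b, hb, hbt⟩ := exists_le_christoffelX hXc hfstX hYpos (smul_restrict_le_fst c hle) hx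
  have hφpos : ∀ t, 0 < christoffelX μ.fst t x := fun t => lt_of_lt_of_le (by positivity) (hbt t)
  refine ⟨fun t => exists_isChristoffelDisintegration (hintm t) (hpd t) (hφpos t),
    fun ν hν => ?_, fun κ hκ => ?_⟩
  · obtain ⟨q, ρ, hq, hqz, hρ, hρ1, hqρ⟩ := exists_needle (continuous_coordXY n)
      (coordXY_injective n) hcompact hxy
    have hdecay : ∀ t, christoffelXY μ t (x, y) ≤ μ.real Set.univ / ρ * ρ ^ t := fun t =>
      christoffel_le_of_needle (coordXY n) μ t hq hqz hρ hρ1.le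
        (Filter.Eventually.mono (mem_ae_iff.2 hμΩ) hqρ)
    have hμpos : ∀ t, 0 < christoffelXY μ t (x, y) := fun t => by
      have := christoffel_eq_inv_monomialFun (coordXY n) μ t (x, y) (hintm t) (hpd t)
      exact lt_of_lt_of_eq (inv_pos.2 this.1) this.2.symm
    have hpos : ∀ t, 0 < christoffelY (ν t) t y := fun t =>
      pos_of_mul_pos_right ((hν t).2 y ▸ hμpos t) (hφpos t).le
    refine ⟨hpos, decaysExponentially_of_le (fun t => (hpos t).le)
      (C := μ.real Set.univ / ρ / b) (k := 2 * n) hρ hρ1 fun t => ?_⟩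
    -- Dividing the geometric bound for μ by the polynomial lower bound for φ costs only the factor
    -- (t+3)^(2n)/b.
    have h1 := hdecay t
    rw [(hν t).2 y] at h1
    have h2 := (mul_le_mul_of_nonneg_right (hbt t) (hpos t).le).trans h1
    have h3 : (0 : ℝ) < (t + 3) ^ (2 * n) := by positivity
    calc christoffelY (ν t) t y
        = (b * ((t + 3 : ℝ) ^ (2 * n))⁻¹ * christoffelY (ν t) t y) * ((t + 3) ^ (2 * n) / b) := by
          field_simp
      _ ≤ (μ.real Set.univ / ρ * ρ ^ t) * ((t + 3) ^ (2 * n) / b) := by gcongr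
      _ = _ := by ring
  · obtain ⟨hκm, -, hκY⟩ := hκ
    refine ⟨christoffel_antitone (σ := Fin 1) (fun w : ℝ => fun _ => w) (κ x) y, ?_⟩
    obtain ⟨q, ρ, hq, hqz, hρ, hρ1, hqρ⟩ := exists_needle (σ := Fin 1)
      (c := fun w : ℝ => fun _ => w) (by fun_prop) (fun v w h => congrFun h 0) hYc hy
    refine decaysExponentially_of_le (fun t => christoffel_nonneg (σ := Fin 1) (fun w : ℝ => fun _ => w) (κ x) t y)
      (C := (κ x).real Set.univ / ρ) (k := 0) hρ hρ1 fun t => ?_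
    rw [pow_zero, mul_one]
    exact christoffel_le_of_needle (fun w : ℝ => fun _ => w) (κ x) t hq hqz hρ hρ1.le
      (Filter.Eventually.mono (mem_ae_iff.2 (hκY x hxX)) hqρ)
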